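/- Let $\mathcal G$ be a finite acyclic causal graph whose vertices are treatment variables $\mathbf X$ and target variables $\mathbf Y=\{Y_1,\dots,Y_m\}$ (there are no non-manipulative variables), with directed edges and with bidirected edges marking pairs of variables that share unobserved confounders. An SCM conforming to $\mathcal G$ consists of finitely many independent real exogenous variables $\mathbf U$ with given laws; a set $\mathbf U^V\subseteq\mathbf U$ for each vertex $V$, such that for $V\ne W$ one has $\mathbf U^V\cap\mathbf U^W\neq\varnothing$ if and only if $V,W$ are joined by a bidirected edge; measurable real-valued structural functions $V=f_V(\mathrm{pa}(V)_{\mathcal G},\mathbf U^V)$; and for each $X\in\mathbf X$ a nondegenerate interval $\mathcal D(X)\subseteq\mathbb R$ of values to which $X$ may be set. For $\mathbf X_s\subseteq\mathbf X$ let $\mathcal D(\mathbf X_s)=\prod_{X\in\mathbf X_s}\mathcal D(X)$; for $\mathbf x_s\in\mathcal D(\mathbf X_s)$ let $\mu_i(\mathbf X_s,\mathbf x_s)=\mathbb E[Y_i\mid \mathrm{do}(\mathbf X_s=\mathbf x_s)]$, where the equations of the variables in $\mathbf X_s$ are replaced by the constants $\mathbf x_s$. All these expectations are assumed to exist. Write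 $\boldsymbol\mu=(\mu_1,\dots,\mu_m)$ and compare vectors componentwise. For a collection $\mathcal S\subseteq\mathbb P(\mathbf X)$, a pair $(\mathbf X_s,\mathbf x_s)$ with $\mathbf X_s\in\mathcal S$ and $\mathbf x_s\in\mathcal D(\mathbf X_s)$ is Pareto-optimal for $\mathcal S$ if no pair $(\mathbf X_s',\mathbf x_s')$ with $\mathbf X_s'\in\mathcal S$, $\mathbf x_s'\in\mathcal D(\mathbf X_s')$ satisfies $\mu_i(\mathbf X_s',\mathbf x_s')\le\mu_i(\mathbf X_s,\mathbf x_s)$ for all $i$, with strict inequality for at least one $i$. The causal Pareto front $\mathcal P_f^{\mathsf c}(\mathcal S)$ is the set of the vectors $\boldsymbol\mu(\mathbf X_s,\mathbf x_s)$ over all pairs that are Pareto-optimal for $\mathcal S$. Let $\mathcal K$ be either the class of all SCMs conforming to $\mathcal G$, or the subclass of those in which $f_X$ takes its values in $\mathcal D(X)$ for every $X\in\mathbf X$ (so that $\mathcal D(X)$ is the domain of the variable $X$). A set $\mathbf X_s\subseteq\mathbf X$ is a minimal intervention set if there is no proper subset $\mathbf X_s'\subset\mathbf X_s$ such that, for every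 SCM in $\mathcal K$ and every $\mathbf x_s\in\mathcal D(\mathbf X_s)$, $\boldsymbol\mu(\mathbf X_s,\mathbf x_s)=\boldsymbol\mu(\mathbf X_s',\mathbf x_s[\mathbf X_s'])$, where $\mathbf x_s[\mathbf X_s']$ is the restriction of $\mathbf x_s$ to $\mathbf X_s'$. A minimal intervention set $\mathbf X_s$ is possibly Pareto-optimal if for at least one SCM in $\mathcal K$ there is $\mathbf x_s\in\mathcal D(\mathbf X_s)$ such that $(\mathbf X_s,\mathbf x_s)$ is Pareto-optimal for $\mathbb P(\mathbf X)$, and such that $\boldsymbol\mu(\mathbf X_s',\mathbf x_s')\le\boldsymbol\mu(\mathbf X_s,\mathbf x_s)$ holds for no minimal intervention set $\mathbf X_s'\neq\mathbf X_s$ and no $\mathbf x_s'\in\mathcal D(\mathbf X_s')$. Let $\mathbb O_{\mathcal G,\mathbf Y}$ be the collection of all possibly Pareto-optimal minimal intervention sets. Then, for every SCM in $\mathcal K$, $$\mathcal P_f^{\mathsf c}(\mathbb P(\mathbf X))=\mathcal P_f^{\mathsf c}(\mathbb O_{\mathcal G,\mathbf Y}).$$ -/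

import Mathlib

open MeasureTheory

/-- An acyclic causal graph on the endogenous variables `V`: directed edges together with
bidirected edges (`conf.Adj v w`: there are unobserved confounders between `v` and `w`). -/
structure CausalGraph (V : Type*) where
  edge : V → V → Prop
  conf : SimpleGraph V
  acyclic : ∀ v, ¬ Relation.TransGen edge v v

theorem CausalGraph.wellFounded {V : Type*} [Finite V] (G : CausalGraph V) :
    WellFounded G.edge := by
  have : Std.Irrefl (Relation.TransGen G.edge) := ⟨G.acyclic⟩
  have h : WellFounded (Relation.TransGen G.edge) := Finite.wellFounded_of_trans_of_irrefl _
  exact Subrelation.wf (fun hab => Relation.TransGen.single hab) h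

/-- A real-valued structural causal model with associated graph `G`, without the requirement that
the targets have expectations. The endogenous variables are the treatment variables (`Sum.inl t`,
`t : X`) and the `m` target variables (`Sum.inr i`). -/
structure CausalModel {X : Type*} {m : ℕ} (G : CausalGraph (X ⊕ Fin m)) where
  /-- number of exogenous variables -/
  k : ℕ
  /-- laws of the exogenous variables, which are independent -/
  law : Fin k → Measure ℝ
  isProb : ∀ j, IsProbabilityMeasure (law j)
  /-- the exogenous variables that affect a given endogenous variable -/
  exo : X ⊕ Fin m → Set (Fin k)
  conf_iff : ∀ v w, v ≠ w → (G.conf.Adj v w ↔ (exo v ∩ exo w).Nonempty)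
  /-- structural functions of the graph parents and of the exogenous variables in `exo v` -/
  f : (v : X ⊕ Fin m) → ({w // G.edge w v} → ℝ) → (exo v → ℝ) → ℝ
  measurable_f : ∀ v, Measurable (Function.uncurry (f v))
  /-- interventional domain of each treatment variable: a nondegenerate interval -/
  dom : X → Set ℝ
  dom_ordConnected : ∀ t, (dom t).OrdConnected
  dom_nontrivial : ∀ t, (dom t).Nontrivial

namespace CausalModel

variable {X : Type*} [Finite X] {m : ℕ} {G : CausalGraph (X ⊕ Fin m)}

/-- The interventional domain of an intervention set. -/
def idom (M : CausalModel G) (s : Set X) : Set (s → ℝ) := {x | ∀ t : s, x t ∈ M.dom t}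

open Classical in
/-- The values of all endogenous variables under the intervention `do(s = x)`, given the values
`u` of the exogenous variables: the equations of the variables in `s` are replaced by constants. -/
noncomputable def doValue (M : CausalModel G) (s : Set X) (x : s → ℝ) (u : Fin M.k → ℝ) :
    X ⊕ Fin m → ℝ :=
  G.wellFounded.fix fun v rec =>
    match v, rec with
    | Sum.inl t, rec =>
      if h : t ∈ s then x ⟨t, h⟩ else M.f (Sum.inl t) (fun w => rec w.1 w.2) (fun j => u j)
    | Sum.inr i, rec => M.f (Sum.inr i) (fun w => rec w.1 w.2) (fun j => u j)

/-- Joint law of the exogenous variables. -/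
noncomputable def exoLaw (M : CausalModel G) : Measure (Fin M.k → ℝ) :=
  haveI := M.isProb
  Measure.pi M.law

end CausalModel

/-- A structural causal model conforming to `G`, in which the targets are integrable under every
admissible intervention. -/
structure SCM {X : Type*} [Finite X] {m : ℕ} (G : CausalGraph (X ⊕ Fin m)) extends
    CausalModel G where
  integrable : ∀ (s : Set X) (x : s → ℝ), x ∈ toCausalModel.idom s → ∀ i : Fin m,
    Integrable (fun u => toCausalModel.doValue s x u (Sum.inr i)) toCausalModel.exoLaw

namespace SCM

variable {X : Type*} [Finite X] {m : ℕ} {G : CausalGraph (X ⊕ Fin m)}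

/-- `μ(s, x)`: the vector of the expectations of the targets under `do(s = x)`. -/
noncomputable def mean (M : SCM G) (s : Set X) (x : s → ℝ) : Fin m → ℝ :=
  fun i => ∫ u, M.doValue s x u (Sum.inr i) ∂M.exoLaw

/-- The treatment variables also take their non-intervened values in their interventional
domains, that is, `dom t` is the domain of the variable `t`. -/
def DomainClosed (M : SCM G) : Prop := ∀ t pa u, M.f (Sum.inl t) pa u ∈ M.dom t

/-- The causal Pareto set for a collection `S` of intervention sets. -/
def causalParetoSet (M : SCM G) (S : Set (Set X)) : Set (Σ s : Set X, (s → ℝ)) :=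
  {p | p.1 ∈ S ∧ p.2 ∈ M.idom p.1 ∧
    ¬ ∃ q : Σ s : Set X, (s → ℝ), q.1 ∈ S ∧ q.2 ∈ M.idom q.1 ∧
      (∀ i, M.mean q.1 q.2 i ≤ M.mean p.1 p.2 i) ∧ ∃ i, M.mean q.1 q.2 i < M.mean p.1 p.2 i}

/-- The causal Pareto front for a collection `S` of intervention sets. -/
def causalParetoFront (M : SCM G) (S : Set (Set X)) : Set (Fin m → ℝ) :=
  (fun p : Σ s : Set X, (s → ℝ) => M.mean p.1 p.2) '' M.causalParetoSet S

end SCM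

/-- `s` is a minimal intervention set, with respect to the class `K` of models: no proper subset
of `s` yields the same expected targets in all models of the class. -/
def IsMinimalInterventionSet {X : Type*} [Finite X] {m : ℕ} {G : CausalGraph (X ⊕ Fin m)}
    (K : Set (SCM G)) (s : Set X) : Prop :=
  ¬ ∃ (s' : Set X) (h : s' ⊂ s), ∀ M ∈ K, ∀ x ∈ M.idom s,
    M.mean s x = M.mean s' (x ∘ Set.inclusion h.subset)

/-- The possibly Pareto-optimal minimal intervention sets, with respect to the class `K`. -/
def possiblyParetoOptimalMIS {X : Type*} [Finite X] {m : ℕ} {G : CausalGraph (X ⊕ Fin m)}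
    (K : Set (SCM G)) : Set (Set X) :=
  {s | IsMinimalInterventionSet K s ∧
    ∃ M ∈ K, ∃ x ∈ M.idom s, ⟨s, x⟩ ∈ M.causalParetoSet Set.univ ∧
      ∀ s', IsMinimalInterventionSet K s' → s' ≠ s → ∀ x' ∈ M.idom s',
        ¬ ∀ i, M.mean s' x' i ≤ M.mean s x i}

/-!
It suffices to show that every intervention is weakly dominated, in the given model, by an
intervention on some possibly Pareto-optimal set (`SCM.causalParetoFront_univ_eq`). Here it is
important that the dominating intervention need not itself be Pareto-optimal, as infima over
interventional domains need not be attained. A set is possibly Pareto-optimal as soon as in some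
model one of its interventions is weakly dominated by no other intervention on a minimal
intervention set (`mem_possiblyParetoOptimalMIS`). Such models are provided by a construction
with fair exogenous bits, `SignalData.scm`. Under an intervention on `s`, every vertex passes on
to its children all the bits that have reached it, checks whether the messages of its parents are
consistent with each other and with its own bits, and reports any inconsistency; the natural values
of the vertices in `s` count as inconsistent. An intervention thus claims fixed values of certain
bits, and if the true value of one of these also reaches some target by another route, then an
inconsistency arises half of the time (`SignalData.not_forall_view_bit`), which is made so costly
that the intervention is not competitive.

If treatments may take values outside of their interventional domains, then a treatment can reveal
by its value whether it has been set. Hence every minimal intervention set is possibly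
Pareto-optimal, and every set can be reduced to a minimal one.

For domain-closed models, the territory of a target, for interventions on `s`, is a set of vertices
with a path to the target that avoids `s`; it contains the target and is closed under confounding
and under children. A non-intervened parent of the territory belongs to it if it lies in the
territory of some other target, or is also a parent of such a territory: in the latter case the
parent may serve to randomise between the targets, which can be better than any fixed
value. The territories are generated by adjoining such common parents one after the other
(`Admissible`, `exists_admissible_closed`). For each target, the values of the boundary of the
territory are independent of the exogenous variables of the territory, so that the mean of the
target is an average over the values of the boundary, and some value is at least as good as the
average. As non-intervened boundary vertices of distinct territories are distinct, these values can
be chosen for all targets at once (`SCM.DomainClosed.exists_boundary_le`), so that the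
intervention on `s` is weakly dominated by one on the union of the boundaries.

This union is possibly Pareto-optimal (`boundary_mem_possiblyParetoOptimalMIS`), because any
intervention on a territory is penalised in a suitable signalling model. For closure under
confounding and children, this is the penalty for inconsistencies. For a common parent adjoined for
the targets `i` and `j`, one charges `i` if the bit of the parent is `false`, and `j` if it is
`true`: a fixed value puts the full charge on one of the two, while the natural value halves both
charges. With weights that decrease quickly in the order of adjunction, this loss cannot be
compensated by gains from vertices adjoined later (`SignalData.live_of_tradeoff`).
-/

/-! ### Ancestors, interventions and minimal intervention sets -/

/-- `G.Anc B v w`: there is a directed path from `v` to `w` all of whose vertices, except possibly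
`w`, lie outside `B`. -/
def CausalGraph.Anc {V : Type*} (G : CausalGraph V) (B : Set V) : V → V → Prop :=
  Relation.ReflTransGen fun a b => G.edge a b ∧ a ∉ B

namespace CausalModel

variable {X : Type*} [Finite X] {m : ℕ} {G : CausalGraph (X ⊕ Fin m)}

theorem doValue_of_mem (M : CausalModel G) {s : Set X} (x : s → ℝ) (u : Fin M.k → ℝ) {t : X}
    (h : t ∈ s) : M.doValue s x u (Sum.inl t) = x ⟨t, h⟩ := by
  rw [doValue, WellFounded.fix_eq]
  simp [h]

theorem doValue_of_notMem (M : CausalModel G) {s : Set X} (x : s → ℝ) (u : Fin M.k → ℝ)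
    {v : X ⊕ Fin m} (h : v ∉ Sum.inl '' s) :
    M.doValue s x u v = M.f v (fun w => M.doValue s x u w.1) (fun j => u j) := by
  rw [doValue, WellFounded.fix_eq]
  cases v with
  | inl t =>
    have h' : t ∉ s := fun ht => h ⟨t, ht, rfl⟩
    simp only [h', dif_neg, not_false_eq_true]
  | inr i => rfl

theorem measurable_doValue (M : CausalModel G) (s : Set X) (x : s → ℝ) (v : X ⊕ Fin m) :
    Measurable fun u => M.doValue s x u v := by
  induction v using G.wellFounded.induction with
  | _ v ih =>
    by_cases h : v ∈ Sum.inl '' s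
    · obtain ⟨t, ht, rfl⟩ := h
      simp only [doValue_of_mem _ _ _ ht]
      exact measurable_const
    · simp only [doValue_of_notMem _ _ _ h]
      exact (M.measurable_f v).comp ((measurable_pi_lambda _ fun w => ih w.1 w.2).prodMk
        (measurable_pi_lambda _ fun j => measurable_pi_apply _))

/-- Removing a variable that is not a parent of an effective ancestor of a vertex does not change
the value of this vertex. -/
theorem doValue_diff_singleton (M : CausalModel G) {s : Set X} (x : s → ℝ) (u : Fin M.k → ℝ)
    (d : X) {y : X ⊕ Fin m} (hy : y ∉ Sum.inl '' s)
    (hd : ∀ a, G.Anc (Sum.inl '' s) a y → ¬ G.edge (Sum.inl d) a)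
    {v : X ⊕ Fin m} (hv : G.Anc (Sum.inl '' s) v y) :
    M.doValue s x u v =
      M.doValue (s \ {d}) (x ∘ Set.inclusion Set.sdiff_subset) u v := by
  induction v using G.wellFounded.induction with
  | _ v ih =>
    have hvs : v ∉ Sum.inl '' s := by
      rcases Relation.ReflTransGen.cases_head hv with rfl | ⟨w, hw, -⟩
      · exact hy
      · exact hw.2
    have hvs' : v ∉ Sum.inl '' (s \ {d}) := fun h => hvs (Set.image_mono Set.sdiff_subset h)
    rw [doValue_of_notMem _ _ _ hvs, doValue_of_notMem _ _ _ hvs']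
    congr 1
    funext ⟨w, hw⟩
    by_cases hws : w ∈ Sum.inl '' s
    · obtain ⟨t, ht, rfl⟩ := hws
      have htd : t ≠ d := fun h => hd v hv (h ▸ hw)
      have ht' : t ∈ s \ {d} := ⟨ht, htd⟩
      simp only [doValue_of_mem _ _ _ ht, doValue_of_mem _ _ _ ht']
      rfl
    · exact ih w hw (Relation.ReflTransGen.head ⟨hw, hws⟩ hv)

instance (M : CausalModel G) : IsProbabilityMeasure M.exoLaw := by
  have := M.isProb
  unfold exoLaw
  infer_instance

end CausalModel

section MIS

variable {X : Type*} [Finite X] {m : ℕ} {G : CausalGraph (X ⊕ Fin m)} {K : Set (SCM G)}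

theorem IsMinimalInterventionSet.exists_edge_anc {s : Set X} (hs : IsMinimalInterventionSet K s)
    {d : X} (hd : d ∈ s) :
    ∃ i a, G.Anc (Sum.inl '' s) a (Sum.inr i) ∧ G.edge (Sum.inl d) a := by
  by_contra! hcon
  refine hs ⟨s \ {d}, ⟨Set.sdiff_subset, fun h => (h hd).2 rfl⟩, fun M _ x _ => ?_⟩
  funext i
  unfold SCM.mean
  congr 1
  funext u
  exact M.doValue_diff_singleton x u d (by simp) (hcon i) Relation.ReflTransGen.refl

theorem exists_isMinimalInterventionSet (K : Set (SCM G)) (s : Set X) :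
    ∃ (s' : Set X) (h : s' ⊆ s), IsMinimalInterventionSet K s' ∧ ∀ M ∈ K, ∀ x ∈ M.idom s,
      M.mean s x = M.mean s' (x ∘ Set.inclusion h) := by
  induction s using (wellFounded_lt (α := Set X)).induction with
  | _ s ih =>
    by_cases hs : IsMinimalInterventionSet K s
    · exact ⟨s, subset_rfl, hs, fun M _ x _ => rfl⟩
    · obtain ⟨s₁, h₁, hm⟩ := not_not.1 hs
      obtain ⟨s₂, h₂, hmin, hm₂⟩ := ih s₁ h₁
      refine ⟨s₂, h₂.trans h₁.subset, hmin, fun M hM x hx => ?_⟩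
      rw [hm M hM x hx, hm₂ M hM (x ∘ Set.inclusion h₁.subset)
        fun t => hx (Set.inclusion h₁.subset t)]
      rfl

/-- A set is possibly Pareto-optimal as soon as, in some model, one of its interventions is weakly
dominated by no other intervention on a minimal intervention set. -/
theorem mem_possiblyParetoOptimalMIS {s : Set X} {M : SCM G} (hM : M ∈ K) {x : s → ℝ}
    (hx : x ∈ M.idom s)
    (h : ∀ s', IsMinimalInterventionSet K s' → ∀ x' ∈ M.idom s', M.mean s' x' ≤ M.mean s x →
      (⟨s', x'⟩ : Σ s : Set X, (s → ℝ)) = ⟨s, x⟩) :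
    s ∈ possiblyParetoOptimalMIS K := by
  have hred : ∀ q : Σ s : Set X, (s → ℝ), q.2 ∈ M.idom q.1 → M.mean q.1 q.2 ≤ M.mean s x →
      s ⊆ q.1 ∧ IsMinimalInterventionSet K s ∧ M.mean q.1 q.2 = M.mean s x := by
    rintro ⟨q, y⟩ hy hle
    obtain ⟨s', hs', hmin, hmean⟩ := exists_isMinimalInterventionSet K q
    have hEq := hmean M hM y hy
    simp only at hle ⊢
    rw [hEq] at hle ⊢
    have := h s' hmin (y ∘ Set.inclusion hs') (fun t => hy (Set.inclusion hs' t)) hle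
    obtain ⟨rfl, hxx⟩ := Sigma.mk.inj_iff.1 this
    exact ⟨hs', hmin, by rw [eq_of_heq hxx]⟩
  refine ⟨(hred ⟨s, x⟩ hx le_rfl).2.1, M, hM, x, hx, ⟨trivial, hx, ?_⟩, ?_⟩
  · rintro ⟨q, -, hq, hle, i, hi⟩
    exact hi.ne (congrFun (hred q hq hle).2.2 i)
  · intro s' hs' hne x' hx' hle
    exact hne (Sigma.mk.inj_iff.1 (h s' hs' x' hx' hle)).1

theorem SCM.causalParetoFront_univ_eq (M : SCM G) {S : Set (Set X)}
    (h : ∀ s, ∀ x ∈ M.idom s, ∃ s' ∈ S, ∃ x' ∈ M.idom s', M.mean s' x' ≤ M.mean s x) :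
    M.causalParetoFront Set.univ = M.causalParetoFront S := by
  ext v
  constructor
  · rintro ⟨⟨s, x⟩, ⟨-, hx, hopt⟩, rfl⟩
    obtain ⟨s', hs', x', hx', hle⟩ := h s x hx
    have hEq : M.mean s' x' = M.mean s x := by
      by_contra hne
      obtain ⟨i, hi⟩ := (Pi.lt_def.1 (lt_of_le_of_ne hle hne)).2
      exact hopt ⟨⟨s', x'⟩, trivial, hx', hle, i, hi⟩
    refine ⟨⟨s', x'⟩, ⟨hs', hx', ?_⟩, hEq⟩
    rintro ⟨q, -, hq, hqle, hlt⟩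
    simp only [hEq] at hqle hlt
    exact hopt ⟨q, trivial, hq, hqle, hlt⟩
  · rintro ⟨⟨s, x⟩, ⟨hs, hx, hopt⟩, rfl⟩
    refine ⟨⟨s, x⟩, ⟨trivial, hx, ?_⟩, rfl⟩
    rintro ⟨⟨q, y⟩, -, hy, hle, i, hi⟩
    obtain ⟨s', hs', x', hx', hle'⟩ := h q y hy
    exact hopt ⟨⟨s', x'⟩, hs', hx', fun j => (hle' j).trans (hle j), i, (hle' i).trans_lt hi⟩

end MIS

/-! ### Fair bits and the encoding of bit vectors by real numbers -/

/-- The law of a fair bit, realised on `{0, 1} ⊆ ℝ`. -/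
noncomputable def fairCoin : Measure ℝ :=
  (2⁻¹ : ENNReal) • Measure.dirac 0 + (2⁻¹ : ENNReal) • Measure.dirac 1

instance : IsProbabilityMeasure fairCoin :=
  ⟨by simp [fairCoin, ENNReal.inv_two_add_inv_two]⟩

/-- The bits represented by a vector of exogenous values. -/
noncomputable def bits {k : ℕ} (u : Fin k → ℝ) : Fin k → Bool := fun j => decide (u j = 1)

theorem measurable_bits {k : ℕ} : Measurable (bits (k := k)) := by
  refine measurable_pi_lambda _ fun j => ?_
  refine (measurable_to_bool ?_)
  have : (fun u : Fin k → ℝ => bits u j) ⁻¹' {true} = {u | u j = 1} := by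
    ext u; simp [bits]
  rw [this]
  exact measurableSet_eq_fun (measurable_pi_apply j) measurable_const

theorem integral_fairCoin (β : Bool) :
    ∫ r, (if decide (r = 1) = β then (1 : ℝ) else 0) ∂fairCoin = 1 / 2 := by
  have hint : ∀ (a : ℝ), Integrable (fun r : ℝ => if decide (r = 1) = β then (1 : ℝ) else 0)
      ((2⁻¹ : ENNReal) • Measure.dirac a) := fun a =>
    (integrable_dirac (by simp)).smul_measure (by simp)
  rw [fairCoin, integral_add_measure (hint 0) (hint 1), integral_smul_measure,
    integral_smul_measure, integral_dirac, integral_dirac]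
  cases β <;> simp

/-- The joint law of `k` independent fair bits. -/
noncomputable def coinLaw (k : ℕ) : Measure (Fin k → ℝ) := Measure.pi fun _ => fairCoin

instance (k : ℕ) : IsProbabilityMeasure (coinLaw k) := by unfold coinLaw; infer_instance

/-- The value `1` if the bit `j` equals `β`, and `0` otherwise. -/
def bitTest {k : ℕ} (j : Fin k) (β : Bool) (b : Fin k → Bool) : ℕ := if b j = β then 1 else 0

theorem integral_bitTest {k : ℕ} (j : Fin k) (β : Bool) :
    ∫ u, (bitTest j β (bits u) : ℝ) ∂coinLaw k = 1 / 2 := by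
  have h := (measurePreserving_eval (fun _ : Fin k => fairCoin) j).map_eq
  have hF : Measurable fun r : ℝ => if decide (r = 1) = β then (1 : ℝ) else 0 := by
    refine Measurable.ite ?_ measurable_const measurable_const
    cases β
    · convert (measurableSet_singleton (1 : ℝ)).compl using 1
      ext r; simp
    · convert measurableSet_singleton (1 : ℝ) using 1
      ext r; simp
  have h2 := integral_map (μ := coinLaw k) (φ := fun u => u j)
    (measurable_pi_apply j).aemeasurable hF.aestronglyMeasurable
  rw [show Measure.map (fun u => u j) (coinLaw k) = fairCoin from h, integral_fairCoin] at h2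
  rw [h2]
  refine integral_congr_ae (ae_of_all _ fun u => ?_)
  by_cases hb : bits u j = β
  · simp only [bitTest, if_pos hb, if_pos (show decide (u j = 1) = β from hb), Nat.cast_one]
  · simp only [bitTest, if_neg hb, if_neg (show ¬ decide (u j = 1) = β from hb), Nat.cast_zero]

theorem integrable_comp_bits {k : ℕ} (g : (Fin k → Bool) → ℝ) :
    Integrable (fun u => g (bits u)) (coinLaw k) := by
  obtain ⟨C, hC⟩ := (Set.finite_range fun b => ‖g b‖).bddAbove
  exact Integrable.of_bound ((measurable_of_finite g).comp measurable_bits).aestronglyMeasurable C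
    (ae_of_all _ fun u => hC ⟨bits u, rfl⟩)

/-- An injective encoding of bit vectors by numbers in `[0, 1)`. -/
noncomputable def code {k : ℕ} (b : Fin k → Bool) : ℝ :=
  ((Fintype.equivFin (Fin k → Bool) b : ℕ) : ℝ) / Fintype.card (Fin k → Bool)

theorem code_nonneg {k : ℕ} (b : Fin k → Bool) : 0 ≤ code b := by unfold code; positivity

theorem code_lt_one {k : ℕ} (b : Fin k → Bool) : code b < 1 := by
  unfold code
  rw [div_lt_one (by exact_mod_cast Fintype.card_pos)]
  exact_mod_cast (Fintype.equivFin (Fin k → Bool) b).2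

theorem code_injective {k : ℕ} : Function.Injective (code (k := k)) := by
  intro b b' h
  unfold code at h
  have hc : (Fintype.card (Fin k → Bool) : ℝ) ≠ 0 := by exact_mod_cast Fintype.card_ne_zero
  rw [div_left_inj' hc] at h
  exact (Fintype.equivFin _).injective (Fin.ext (by exact_mod_cast h))

theorem natCast_add_code_inj {k : ℕ} {a a' : ℕ} {b b' : Fin k → Bool}
    (h : (a : ℝ) + code b = a' + code b') : b = b' := by
  have h1 := code_nonneg b
  have h2 := code_lt_one b
  have h3 := code_nonneg b'
  have h4 := code_lt_one b'
  have ha : a = a' := by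
    have h5 : (a : ℝ) < a' + 1 := by linarith
    have h6 : (a' : ℝ) < a + 1 := by linarith
    norm_cast at h5 h6
    omega
  subst ha
  exact code_injective (by linarith)

/-! ### The signalling model -/

/-- The exogenous variables that enter `v` along directed paths whose vertices, except possibly
`v`, lie outside `B`. -/
def CausalGraph.visible {V : Type*} (G : CausalGraph V) (B : Set V) {k : ℕ}
    (exo : V → Set (Fin k)) (v : V) : Set (Fin k) :=
  {j | ∃ a, G.Anc B a v ∧ j ∈ exo a}

theorem CausalGraph.visible_mono {V : Type*} (G : CausalGraph V) {B : Set V} {k : ℕ}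
    {exo : V → Set (Fin k)} {v w : V} (h : G.Anc B v w) : G.visible B exo v ⊆ G.visible B exo w :=
  fun _ ⟨a, ha, hj⟩ => ⟨a, ha.trans h, hj⟩

/-- The data of a signalling model: the intervention set `s` to be singled out, the exogenous bits
of the vertices, an integer cost of each vertex (zero at the treatment variables) that depends on
the bits visible to the vertex only, and a common interventional domain of the treatments. -/
structure SignalData {X : Type*} {m : ℕ} (G : CausalGraph (X ⊕ Fin m)) where
  s : Set X
  k : ℕ
  exo : X ⊕ Fin m → Set (Fin k)
  conf_iff : ∀ v w, v ≠ w → (G.conf.Adj v w ↔ (exo v ∩ exo w).Nonempty)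
  cost : X ⊕ Fin m → (Fin k → Bool) → ℕ
  cost_congr : ∀ v b b', (∀ j ∈ G.visible (Sum.inl '' s) exo v, b j = b' j) →
    cost v b = cost v b'
  cost_inl : ∀ t b, cost (Sum.inl t) b = 0
  bound : ℕ
  cost_le : ∀ v b, cost v b ≤ bound
  dom : Set ℝ
  dom_ordConnected : dom.OrdConnected
  dom_nontrivial : dom.Nontrivial
  one_mem : 1 ∈ dom

namespace SignalData

variable {X : Type*} {m : ℕ} {G : CausalGraph (X ⊕ Fin m)}

/-- The intervention set, as a set of vertices. -/
abbrev cut (S : SignalData G) : Set (X ⊕ Fin m) := Sum.inl '' S.s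

/-- The exogenous bits that are visible to `v` under an intervention on `S.s`. -/
abbrev vis (S : SignalData G) (v : X ⊕ Fin m) : Set (Fin S.k) := G.visible S.cut S.exo v

open Classical in
/-- The value that `v` is supposed to have when the exogenous bits are `b`: the vertices of `S.s`
have the value `1`, and all others transmit the bits visible to them, on top of their cost. -/
noncomputable def signal (S : SignalData G) (v : X ⊕ Fin m) (b : Fin S.k → Bool) : ℝ :=
  if v ∈ S.cut then 1 else S.cost v b + code fun j => if j ∈ S.vis v then b j else false

/-- The value by which a vertex signals an inconsistency. It exceeds all regular signals, and is
more than twice the mean of a target under the intervention on `S.s`. -/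
noncomputable def err (S : SignalData G) : ℝ := 2 * S.bound + 4

theorem signal_of_mem {S : SignalData G} {v : X ⊕ Fin m} (hv : v ∈ S.cut) (b : Fin S.k → Bool) :
    S.signal v b = 1 := by
  simp only [signal, if_pos hv]

theorem cost_le_signal {S : SignalData G} {v : X ⊕ Fin m} (hv : v ∉ S.cut)
    (b : Fin S.k → Bool) : (S.cost v b : ℝ) ≤ S.signal v b := by
  simp only [signal, if_neg hv]
  linarith [code_nonneg fun j => open Classical in if j ∈ S.vis v then b j else false]

theorem signal_lt {S : SignalData G} {v : X ⊕ Fin m} (hv : v ∉ S.cut)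
    (b : Fin S.k → Bool) : S.signal v b < S.cost v b + 1 := by
  simp only [signal, if_neg hv]
  linarith [code_lt_one fun j => open Classical in if j ∈ S.vis v then b j else false]

theorem signal_nonneg {S : SignalData G} (v : X ⊕ Fin m) (b : Fin S.k → Bool) :
    0 ≤ S.signal v b := by
  by_cases hv : v ∈ S.cut
  · rw [signal_of_mem hv]; exact zero_le_one
  · exact (Nat.cast_nonneg _).trans (cost_le_signal hv b)

theorem signal_lt_err {S : SignalData G} (v : X ⊕ Fin m) (b : Fin S.k → Bool) :
    S.signal v b < S.err := by
  have h0 : (0 : ℝ) ≤ S.bound := Nat.cast_nonneg _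
  unfold err
  by_cases hv : v ∈ S.cut
  · rw [signal_of_mem hv]; linarith
  · have h1 : (S.cost v b : ℝ) ≤ S.bound := by exact_mod_cast S.cost_le v b
    linarith [signal_lt hv b]

theorem signal_congr {S : SignalData G} {v : X ⊕ Fin m} {b b' : Fin S.k → Bool}
    (h : ∀ j ∈ S.vis v, b j = b' j) : S.signal v b = S.signal v b' := by
  have hmask : (fun j => open Classical in if j ∈ S.vis v then b j else false) =
      fun j => open Classical in if j ∈ S.vis v then b' j else false := by
    funext j
    split_ifs with hj
    · exact h j hj
    · rfl
  simp only [signal, S.cost_congr v b b' h, hmask]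

theorem eq_of_signal_eq {S : SignalData G} {v : X ⊕ Fin m} (hv : v ∉ S.cut)
    {b b' : Fin S.k → Bool} (h : S.signal v b = S.signal v b') {j : Fin S.k} (hj : j ∈ S.vis v) :
    b j = b' j := by
  simp only [signal, if_neg hv] at h
  have := congrFun (natCast_add_code_inj h) j
  simpa only [if_pos hj] using this

/-- The bit vectors that are consistent with the values of the parents of `v` and with the
exogenous variables that affect `v`. -/
def consistent (S : SignalData G) (v : X ⊕ Fin m) (pa : {w // G.edge w v} → ℝ)
    (u : S.exo v → ℝ) : Set (Fin S.k → Bool) :=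
  {b | (∀ w, pa w = S.signal w.1 b) ∧ ∀ j : S.exo v, b j = decide (u j = 1)}

/-- Two bit vectors that are consistent with the same data lead to the same signal. -/
theorem signal_eq_of_consistent {S : SignalData G} {v : X ⊕ Fin m} {pa : {w // G.edge w v} → ℝ}
    {u : S.exo v → ℝ} {b b' : Fin S.k → Bool} (hb : b ∈ S.consistent v pa u)
    (hb' : b' ∈ S.consistent v pa u) : S.signal v b = S.signal v b' := by
  refine signal_congr ?_
  rintro j ⟨a, ha, hj⟩
  rcases Relation.ReflTransGen.cases_tail ha with rfl | ⟨w, haw, hw, hws⟩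
  · rw [hb.2 ⟨j, hj⟩, hb'.2 ⟨j, hj⟩]
  · exact eq_of_signal_eq hws ((hb.1 ⟨w, hw⟩).symm.trans (hb'.1 ⟨w, hw⟩)) ⟨a, haw, hj⟩

open Classical in
/-- The response of a vertex outside `S.s` to the set of consistent bit vectors. -/
noncomputable def response (S : SignalData G) (v : X ⊕ Fin m) (C : Set (Fin S.k → Bool)) : ℝ :=
  if v ∈ S.cut then 0 else if h : C.Nonempty then S.signal v h.some else S.err

theorem response_mem_Icc (S : SignalData G) (v : X ⊕ Fin m) (C : Set (Fin S.k → Bool)) :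
    S.response v C ∈ Set.Icc 0 S.err := by
  have h0 : 0 ≤ S.err := by unfold err; positivity
  unfold response
  split_ifs
  · exact ⟨le_rfl, h0⟩
  · exact ⟨signal_nonneg _ _, (signal_lt_err _ _).le⟩
  · exact ⟨h0, le_rfl⟩

theorem inr_notMem (B : Set X) (i : Fin m) : (Sum.inr i : X ⊕ Fin m) ∉ Sum.inl '' B := by simp

variable [Finite X]

theorem measurable_response (S : SignalData G) (v : X ⊕ Fin m) :
    Measurable (Function.uncurry fun pa u => S.response v (S.consistent v pa u)) := by
  have h : Measurable fun p : ({w // G.edge w v} → ℝ) × (S.exo v → ℝ) =>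
      S.consistent v p.1 p.2 := by
    rw [measurable_set_iff]
    intro b
    refine measurableSet_setOfPred.1 ?_
    have hEq : {p : ({w // G.edge w v} → ℝ) × (S.exo v → ℝ) | b ∈ S.consistent v p.1 p.2} =
        (⋂ w, {p | p.1 w = S.signal w.1 b}) ∩ ⋂ j : S.exo v, {p | b j = decide (p.2 j = 1)} := by
      ext p
      simp [consistent]
    rw [hEq]
    refine (MeasurableSet.iInter fun w => ?_).inter (MeasurableSet.iInter fun j => ?_)
    · exact measurableSet_eq_fun ((measurable_pi_apply w).comp measurable_fst) measurable_const
    · have h1 : MeasurableSet {p : ({w // G.edge w v} → ℝ) × (S.exo v → ℝ) | p.2 j = 1} :=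
        measurableSet_eq_fun ((measurable_pi_apply j).comp measurable_snd) measurable_const
      cases b j
      · simpa [eq_comm, Set.compl_ofPred] using h1.compl
      · simpa using h1
  exact (measurable_of_finite (S.response v)).comp h

/-- The causal model in which every vertex outside `S.s` transmits all the bits that it receives,
checks them for consistency, and reports inconsistencies; the natural value `0` of the vertices in
`S.s` counts as an inconsistency. -/
noncomputable def causalModel (S : SignalData G) : CausalModel G where
  k := S.k
  law := fun _ => fairCoin
  isProb := fun _ => inferInstance
  exo := S.exo
  conf_iff := S.conf_iff
  f := fun v pa u => S.response v (S.consistent v pa u)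
  measurable_f := S.measurable_response
  dom := fun _ => S.dom
  dom_ordConnected := fun _ => S.dom_ordConnected
  dom_nontrivial := fun _ => S.dom_nontrivial

theorem integrable_doValue (S : SignalData G) (D : Set X) (x : D → ℝ) (i : Fin m) :
    Integrable (fun u => S.causalModel.doValue D x u (Sum.inr i)) S.causalModel.exoLaw := by
  refine Integrable.of_bound (S.causalModel.measurable_doValue D x _).aestronglyMeasurable S.err
    (ae_of_all _ fun u => ?_)
  rw [CausalModel.doValue_of_notMem _ _ _ (inr_notMem D i)]
  have h : S.causalModel.f (Sum.inr i) (fun w => S.causalModel.doValue D x u w.1)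
      (fun j => u j) ∈ Set.Icc 0 S.err := S.response_mem_Icc _ _
  exact (Real.norm_of_nonneg h.1).trans_le h.2

/-- The signalling model, as a structural causal model. -/
noncomputable def scm (S : SignalData G) : SCM G where
  toCausalModel := S.causalModel
  integrable := fun D x _ i => S.integrable_doValue D x i

end SignalData

/-! ### Deviations in the signalling model -/

namespace CausalGraph

variable {V : Type*} {G : CausalGraph V} {B C : Set V} {v w y : V}

theorem Anc.notMem (h : G.Anc B v y) (hy : y ∉ B) : v ∉ B := by
  rcases Relation.ReflTransGen.cases_head h with rfl | ⟨w, hw, -⟩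
  · exact hy
  · exact hw.2

theorem Anc.edge_head (h : G.Anc B w y) (hvw : G.edge v w) (hv : v ∉ B) : G.Anc B v y :=
  Relation.ReflTransGen.head ⟨hvw, hv⟩ h

theorem Anc.anti (h : G.Anc C v y) (hBC : B ⊆ C) : G.Anc B v y :=
  Relation.ReflTransGen.mono (fun _ _ hab => ⟨hab.1, fun hB => hab.2 (hBC hB)⟩) _ _ h

/-- A path either avoids `C`, or has a last vertex in `C`. -/
theorem Anc.union_or (h : G.Anc B v y) :
    G.Anc (B ∪ C) v y ∨
      ∃ d a, d ∈ C ∧ d ∉ B ∧ G.edge d a ∧ G.Anc (B ∪ C) a y ∧ G.Anc B v d := by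
  induction h using Relation.ReflTransGen.head_induction_on with
  | refl => exact Or.inl Relation.ReflTransGen.refl
  | @head v w hvw _ ih =>
    rcases ih with h | ⟨d, a, hd, hdB, hda, ha, hwd⟩
    · by_cases hvC : v ∈ C
      · exact Or.inr ⟨v, w, hvC, hvw.2, hvw.1, h, Relation.ReflTransGen.refl⟩
      · exact Or.inl (h.edge_head hvw.1 fun hv => hv.elim hvw.2 hvC)
    · exact Or.inr ⟨d, a, hd, hdB, hda, ha, Relation.ReflTransGen.head hvw hwd⟩

end CausalGraph

namespace SignalData

variable {X : Type*} {m : ℕ} {G : CausalGraph (X ⊕ Fin m)} {S : SignalData G}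
  {D : Set X} {x : D → ℝ} {u : Fin S.k → ℝ} {i : Fin m}

/-- The vertices with a path to the target `i` that meets neither `S.s` nor `D`. -/
abbrev Live (S : SignalData G) (D : Set X) (i : Fin m) (a : X ⊕ Fin m) : Prop :=
  G.Anc (S.cut ∪ Sum.inl '' D) a (Sum.inr i)

theorem Live.notMem {a : X ⊕ Fin m} (h : S.Live D i a) : a ∉ S.cut ∧ a ∉ Sum.inl '' D := by
  have h' := CausalGraph.Anc.notMem h (by simp)
  exact ⟨fun h1 => h' (Or.inl h1), fun h2 => h' (Or.inr h2)⟩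

variable [Finite X]

theorem doValue_eq_response {v : X ⊕ Fin m} (hv : v ∉ Sum.inl '' D) :
    S.causalModel.doValue D x u v = S.response v (S.consistent v
      (fun w => S.causalModel.doValue D x u w.1) fun j => u (j : Fin S.k)) :=
  S.causalModel.doValue_of_notMem x u hv

theorem doValue_eq_err_or {v : X ⊕ Fin m} (hv : v ∉ S.cut) (hvD : v ∉ Sum.inl '' D) :
    S.causalModel.doValue D x u v = S.err ∨
      ∃ b, S.causalModel.doValue D x u v = S.signal v b := by
  rw [doValue_eq_response hvD, response, if_neg hv]
  split_ifs with h
  · exact Or.inr ⟨_, rfl⟩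
  · exact Or.inl rfl

/-- If a vertex sends the regular signal of `b`, then so do its parents, and `b` has the true
values at the exogenous bits of the vertex. -/
theorem of_doValue_eq_signal {v : X ⊕ Fin m} (hv : v ∉ S.cut) (hvD : v ∉ Sum.inl '' D)
    {b : Fin S.k → Bool} (h : S.causalModel.doValue D x u v = S.signal v b) :
    (∀ w, G.edge w v → S.causalModel.doValue D x u w = S.signal w b) ∧
      ∀ j ∈ S.exo v, b j = bits u j := by
  rw [doValue_eq_response hvD, response, if_neg hv] at h
  split_ifs at h with hC
  · have hs := hC.some_mem
    have hb : ∀ j ∈ S.vis v, hC.some j = b j := fun j hj => eq_of_signal_eq hv h hj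
    refine ⟨fun w hw => (hs.1 ⟨w, hw⟩).trans ?_, fun j hj => ?_⟩
    · by_cases hws : w ∈ S.cut
      · rw [signal_of_mem hws, signal_of_mem hws]
      · exact signal_congr fun j hj => hb j
          (G.visible_mono (Relation.ReflTransGen.single ⟨hw, hws⟩) hj)
    · rw [← hb j ⟨v, Relation.ReflTransGen.refl, hj⟩]
      exact hs.2 ⟨j, hj⟩
  · exact absurd h (signal_lt_err v b).ne'

/-- Under the intended intervention, all signals are the regular ones. -/
theorem doValue_one (v : X ⊕ Fin m) :
    S.causalModel.doValue S.s (fun _ => 1) u v = S.signal v (bits u) := by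
  induction v using G.wellFounded.induction with
  | _ v ih =>
    by_cases hv : v ∈ S.cut
    · rw [signal_of_mem hv]
      obtain ⟨t, ht, rfl⟩ := hv
      exact S.causalModel.doValue_of_mem _ u ht
    · rw [doValue_eq_response hv, response, if_neg hv]
      have hb : bits u ∈ S.consistent v (fun w => S.causalModel.doValue S.s (fun _ => 1) u w.1)
          fun j => u (j : Fin S.k) := ⟨fun w => ih w.1 w.2, fun j => rfl⟩
      rw [dif_pos ⟨_, hb⟩]
      exact signal_eq_of_consistent (Set.Nonempty.some_mem _) hb

/-- When the exogenous values are `u`, the target `i` sends the regular signal of `b`. -/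
def View (S : SignalData G) (D : Set X) (x : D → ℝ) (i : Fin m) (u : Fin S.k → ℝ)
    (b : Fin S.k → Bool) : Prop :=
  S.causalModel.doValue D x u (Sum.inr i) = S.signal (Sum.inr i) b

theorem View.doValue {b : Fin S.k → Bool} (hb : S.View D x i u b) {a : X ⊕ Fin m}
    (ha : S.Live D i a) : S.causalModel.doValue D x u a = S.signal a b := by
  induction ha using Relation.ReflTransGen.head_induction_on with
  | refl => exact hb
  | @head v w hvw hw ih =>
    exact (of_doValue_eq_signal (Live.notMem hw).1 (Live.notMem hw).2 ih).1 v hvw.1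

theorem View.parent {b : Fin S.k → Bool} (hb : S.View D x i u b) {a d : X ⊕ Fin m}
    (ha : S.Live D i a) (hd : G.edge d a) : S.causalModel.doValue D x u d = S.signal d b :=
  (of_doValue_eq_signal ha.notMem.1 ha.notMem.2 (hb.doValue ha)).1 d hd

theorem View.bit {b : Fin S.k → Bool} (hb : S.View D x i u b) {a : X ⊕ Fin m}
    (ha : S.Live D i a) {j : Fin S.k} (hj : j ∈ S.exo a) : b j = bits u j :=
  (of_doValue_eq_signal ha.notMem.1 ha.notMem.2 (hb.doValue ha)).2 j hj

theorem err_or_view (S : SignalData G) (D : Set X) (x : D → ℝ) (i : Fin m) (u : Fin S.k → ℝ) :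
    S.causalModel.doValue D x u (Sum.inr i) = S.err ∨ ∃ b, S.View D x i u b :=
  doValue_eq_err_or (inr_notMem _ i) (inr_notMem _ i)

theorem mean_eq (S : SignalData G) (D : Set X) (x : D → ℝ) (i : Fin m) :
    S.scm.mean D x i = ∫ u, S.causalModel.doValue D x u (Sum.inr i) ∂coinLaw S.k := rfl

theorem integral_le_mean (g : (Fin S.k → Bool) → ℝ)
    (hg : ∀ u, g (bits u) ≤ S.causalModel.doValue D x u (Sum.inr i)) :
    ∫ u, g (bits u) ∂coinLaw S.k ≤ S.scm.mean D x i :=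
  integral_mono (integrable_comp_bits g) (S.integrable_doValue D x i) hg

theorem mean_one_le (S : SignalData G) (i : Fin m) :
    S.scm.mean S.s (fun _ => 1) i ≤ ∫ u, (S.cost (Sum.inr i) (bits u) : ℝ) ∂coinLaw S.k + 1 := by
  have h : ∫ u, ((S.cost (Sum.inr i) (bits u) : ℝ) + 1) ∂coinLaw S.k =
      ∫ u, (S.cost (Sum.inr i) (bits u) : ℝ) ∂coinLaw S.k + 1 := by
    rw [integral_add (integrable_comp_bits fun b => (S.cost (Sum.inr i) b : ℝ))
      (integrable_const _)]
    simp
  rw [← h, mean_eq]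
  simp only [doValue_one]
  exact integral_mono (integrable_comp_bits fun b => S.signal (Sum.inr i) b)
    (integrable_comp_bits fun b => (S.cost (Sum.inr i) b : ℝ) + 1)
    fun u => (signal_lt (inr_notMem _ i) _).le

theorem mean_one_lt (S : SignalData G) (i : Fin m) :
    S.scm.mean S.s (fun _ => 1) i < S.err / 2 := by
  have h : ∫ u, (S.cost (Sum.inr i) (bits u) : ℝ) ∂coinLaw S.k ≤ S.bound := by
    refine (integral_mono (integrable_comp_bits fun b => (S.cost (Sum.inr i) b : ℝ))
      (integrable_const (S.bound : ℝ)) fun u => ?_).trans_eq (by simp)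
    exact Nat.cast_le.2 (S.cost_le _ _)
  have h1 := S.mean_one_le i
  unfold err
  linarith

/-- An intervention that is not worse at target `i` than the intended one cannot make the true
value of a bit a condition for consistency: half of the time, an inconsistency would arise. -/
theorem not_forall_view_bit (hle : S.scm.mean D x i ≤ S.scm.mean S.s (fun _ => 1) i)
    (j : Fin S.k) (β : Bool) : ¬ ∀ u b, S.View D x i u b → bits u j = β := by
  intro h
  have h1 : ∫ u, S.err * (bitTest j (!β) (bits u) : ℝ) ∂coinLaw S.k ≤ S.scm.mean D x i := by
    refine integral_le_mean (fun b => S.err * (bitTest j (!β) b : ℝ)) fun u => ?_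
    rcases S.err_or_view D x i u with he | ⟨b, hb⟩
    · rw [he]
      have : 0 ≤ S.err := (S.response_mem_Icc (Sum.inr i) ∅).1.trans
        (S.response_mem_Icc (Sum.inr i) ∅).2
      simp only [bitTest]
      split_ifs <;> simp [this]
    · have := h u b hb
      simp only [bitTest, this, Bool.eq_not_self, if_false]
      rw [hb]
      simpa using signal_nonneg _ b
  rw [integral_const_mul, integral_bitTest] at h1
  linarith [S.mean_one_lt i]

theorem exists_view (hle : S.scm.mean D x i ≤ S.scm.mean S.s (fun _ => 1) i) :
    ∃ u b, S.View D x i u b := by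
  by_contra! h
  have h1 : ∫ _, S.err ∂coinLaw S.k ≤ S.scm.mean D x i := by
    refine integral_le_mean (fun _ => S.err) fun u => ?_
    rcases S.err_or_view D x i u with he | ⟨b, hb⟩
    · exact he.ge
    · exact absurd hb (h u b)
  have h2 := S.mean_one_lt i
  have : 0 ≤ S.err := (S.response_mem_Icc (Sum.inr i) ∅).1.trans
    (S.response_mem_Icc (Sum.inr i) ∅).2
  rw [integral_const, probReal_univ, one_smul] at h1
  linarith

/-- If a live vertex has a bit that is visible to a vertex `w`, then `w` is live itself:
otherwise all paths from `w` run through the intervention, whose constants fix this bit. -/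
theorem live_of_mem_vis (hle : S.scm.mean D x i ≤ S.scm.mean S.s (fun _ => 1) i)
    {a w : X ⊕ Fin m} (ha : S.Live D i a) {j : Fin S.k} (hj : j ∈ S.exo a) (hjw : j ∈ S.vis w)
    (hw : G.Anc S.cut w (Sum.inr i)) : S.Live D i w := by
  rcases hw.union_or (C := Sum.inl '' D) with h | ⟨_, a', ⟨d, hdD, rfl⟩, hds, hda', ha', hwd⟩
  · exact h
  exfalso
  have hview : ∀ u b, S.View D x i u b → x ⟨d, hdD⟩ = S.signal (Sum.inl d) b := fun u b hb => by
    rw [← hb.parent ha' hda']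
    exact (S.causalModel.doValue_of_mem x u hdD).symm
  obtain ⟨u₀, b₀, hb₀⟩ := exists_view hle
  refine not_forall_view_bit hle j (b₀ j) fun u b hb => ?_
  rw [← hb.bit ha hj]
  exact eq_of_signal_eq hds ((hview u b hb).symm.trans (hview u₀ b₀ hb₀))
    (G.visible_mono hwd hjw)

/-- An intervention on a minimal set that is nowhere worse than the intended one coincides with
it if it leaves alone all the vertices that are not cut off from the targets by `S.s`. -/
theorem eq_of_forall_live {K : Set (SCM G)} (hD : IsMinimalInterventionSet K D)
    (hle : S.scm.mean D x ≤ S.scm.mean S.s fun _ => 1)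
    (hs : ∀ t ∈ S.s, ∃ i a, G.Anc S.cut a (Sum.inr i) ∧ G.edge (Sum.inl t) a)
    (hlive : ∀ i a, G.Anc S.cut a (Sum.inr i) → S.Live D i a) :
    (⟨D, x⟩ : Σ s : Set X, (s → ℝ)) = ⟨S.s, fun _ => 1⟩ := by
  have hx : ∀ t ∈ S.s, ∃ h : t ∈ D, x ⟨t, h⟩ = 1 := by
    intro t ht
    obtain ⟨i, a, ha, hta⟩ := hs t ht
    obtain ⟨u, b, hb⟩ := exists_view (hle i)
    have hval := hb.parent (hlive i a ha) hta
    rw [signal_of_mem ⟨t, ht, rfl⟩] at hval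
    by_cases htD : t ∈ D
    · exact ⟨htD, (S.causalModel.doValue_of_mem x u htD).symm.trans hval⟩
    · rw [doValue_eq_response (by simpa using htD), response, if_pos ⟨t, ht, rfl⟩] at hval
      exact absurd hval zero_ne_one
  have hDs : D = S.s := by
    refine Set.Subset.antisymm (fun d hd => ?_) fun t ht => (hx t ht).1
    by_contra hds
    obtain ⟨i, a, ha, hda⟩ := hD.exists_edge_anc hd
    have ha' : G.Anc S.cut a (Sum.inr i) :=
      ha.anti (Set.image_mono fun t ht => (hx t ht).1)
    exact (Live.notMem (hlive i _ (ha'.edge_head hda (by simpa using hds)))).2 ⟨d, hd, rfl⟩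
  subst hDs
  exact congrArg (Sigma.mk _) (funext fun t => (hx t t.2).2)

end SignalData

/-! ### Territories of the targets -/

section Territory

variable {X : Type*} {m : ℕ}

/-- The vertices `w` that a list of triples `(w, i, j)` adjoins to the territory of the target
`k`; a triple adjoins `w` to the territories of both `i` and `j`. -/
def Adjoined (l : List ((X ⊕ Fin m) × Fin m × Fin m)) (k : Fin m) (w : X ⊕ Fin m) : Prop :=
  ∃ j, (w, k, j) ∈ l ∨ (w, j, k) ∈ l

/-- The territory of the target `i` under interventions on `s`, relative to a list of adjoined
vertices. Among the vertices with a path to the target that avoids `s`, it is closed under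
confounding and under children, and it contains every non-intervened parent of one of its members
that belongs to the territory of some target. -/
inductive Territory (G : CausalGraph (X ⊕ Fin m)) (s : Set X)
    (l : List ((X ⊕ Fin m) × Fin m × Fin m)) : Fin m → X ⊕ Fin m → Prop
  | target (i) : Territory G s l i (Sum.inr i)
  | adjoined {i v} : Adjoined l i v → Territory G s l i v
  | conf {i v w} : Territory G s l i v → G.conf.Adj v w → G.Anc (Sum.inl '' s) w (Sum.inr i) →
      Territory G s l i w
  | child {i v w} : Territory G s l i v → G.edge v w → G.Anc (Sum.inl '' s) w (Sum.inr i) →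
      Territory G s l i w
  | parent {i j v w} : Territory G s l i v → G.edge w v → w ∉ Sum.inl '' s →
      Territory G s l j w → Territory G s l i w

/-- The lists that are built by adjoining, one after the other, common parents of the current
territories of two distinct targets. -/
inductive Admissible (G : CausalGraph (X ⊕ Fin m)) (s : Set X) :
    List ((X ⊕ Fin m) × Fin m × Fin m) → Prop
  | nil : Admissible G s []
  | cons {l w i j v v'} : Admissible G s l → i ≠ j → w ∉ Sum.inl '' s →
      Territory G s l i v → G.edge w v → Territory G s l j v' → G.edge w v' →
      Admissible G s ((w, i, j) :: l)

variable {G : CausalGraph (X ⊕ Fin m)} {s : Set X} {l l' : List ((X ⊕ Fin m) × Fin m × Fin m)}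
  {i j : Fin m} {v w : X ⊕ Fin m}

theorem Adjoined.mono (h : Adjoined l i v) (hl : l ⊆ l') : Adjoined l' i v :=
  let ⟨j, hj⟩ := h
  ⟨j, hj.imp (fun h => hl h) fun h => hl h⟩

theorem adjoined_cons {a b k : Fin m} {x : X ⊕ Fin m} (h : Adjoined ((w, a, b) :: l) k x) :
    Adjoined l k x ∨ x = w ∧ (k = a ∨ k = b) := by
  obtain ⟨j, h | h⟩ := h
  · rcases List.mem_cons.1 h with h | h
    · simp only [Prod.mk.injEq] at h
      exact Or.inr ⟨h.1, Or.inl h.2.1⟩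
    · exact Or.inl ⟨j, Or.inl h⟩
  · rcases List.mem_cons.1 h with h | h
    · simp only [Prod.mk.injEq] at h
      exact Or.inr ⟨h.1, Or.inr h.2.2⟩
    · exact Or.inl ⟨j, Or.inr h⟩

theorem Territory.mono (h : Territory G s l i v) (hl : l ⊆ l') : Territory G s l' i v := by
  induction h with
  | target i => exact .target i
  | adjoined h => exact .adjoined (h.mono hl)
  | conf _ h1 h2 ih => exact .conf ih h1 h2
  | child _ h1 h2 ih => exact .child ih h1 h2
  | parent _ h1 h2 _ ih ih' => exact .parent ih h1 h2 ih'

theorem Territory.anc_of_adjoined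
    (hl : ∀ i v, Adjoined l i v → G.Anc (Sum.inl '' s) v (Sum.inr i))
    (h : Territory G s l i v) : G.Anc (Sum.inl '' s) v (Sum.inr i) := by
  induction h with
  | target i => exact Relation.ReflTransGen.refl
  | adjoined h => exact hl _ _ h
  | conf _ _ h _ => exact h
  | child _ _ h _ => exact h
  | parent _ h1 h2 _ ih _ => exact ih.edge_head h1 h2

theorem Admissible.anc_of_adjoined (hl : Admissible G s l) :
    ∀ i v, Adjoined l i v → G.Anc (Sum.inl '' s) v (Sum.inr i) := by
  induction hl with
  | nil => rintro i v ⟨j, h | h⟩ <;> simp at h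
  | cons _ _ hw hv hwv hv' hwv' ih =>
    intro k x hx
    rcases adjoined_cons hx with hx | ⟨rfl, rfl | rfl⟩
    · exact ih _ _ hx
    · exact (hv.anc_of_adjoined ih).edge_head hwv hw
    · exact (hv'.anc_of_adjoined ih).edge_head hwv' hw

theorem Territory.anc (h : Territory G s l i v) (hl : Admissible G s l) :
    G.Anc (Sum.inl '' s) v (Sum.inr i) :=
  h.anc_of_adjoined hl.anc_of_adjoined

theorem Territory.notMem (h : Territory G s l i v) (hl : Admissible G s l) :
    v ∉ Sum.inl '' s :=
  (h.anc hl).notMem (by simp)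

/-- Adjoining common parents stops at territories without common parents outside of `s`. -/
theorem exists_admissible_closed [Finite X] (G : CausalGraph (X ⊕ Fin m)) (s : Set X) :
    ∃ l, Admissible G s l ∧ ∀ i j v v' w, i ≠ j → w ∉ Sum.inl '' s → Territory G s l i v →
      G.edge w v → Territory G s l j v' → G.edge w v' → Territory G s l i w := by
  let F : Set (Set (Fin m × (X ⊕ Fin m))) :=
    {T | ∃ l, Admissible G s l ∧ T = {p | Territory G s l p.1 p.2}}
  obtain ⟨T, ⟨l, hl, rfl⟩, hmax⟩ := (Set.toFinite F).exists_maximal ⟨_, [], .nil, rfl⟩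
  refine ⟨l, hl, fun i j v v' w hij hw hv hwv hv' hwv' => ?_⟩
  -- A violation could be adjoined to a list whose territories are maximal.
  have hsub := hmax (y := {p | Territory G s ((w, i, j) :: l) p.1 p.2})
    ⟨_, .cons hl hij hw hv hwv hv' hwv', rfl⟩ fun p hp =>
      Territory.mono hp (List.subset_cons_self _ _)
  exact hsub (a := (i, w)) (.adjoined ⟨j, Or.inl List.mem_cons_self⟩)

end Territory

/-! ### Trade-offs between targets -/

section Cost

variable {X : Type*} {m k : ℕ} (e : X ⊕ Fin m → Fin k)

/-- For every entry `(w, i, j)` of the list, the target `i` is charged if the bit of `w` is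
`false`, and the target `j` is charged if it is `true`. An earlier adjoined vertex matters more than
all the later ones together. -/
def tradeoffCost : List ((X ⊕ Fin m) × Fin m × Fin m) → Fin m → (Fin k → Bool) → ℕ
  | [], _, _ => 0
  | (w, i, j) :: l, t, b => 4 * tradeoffCost l t b +
      4 * ((if t = i then bitTest (e w) false b else 0) +
        if t = j then bitTest (e w) true b else 0)

/-- The mean of `tradeoffCost` for fair bits. -/
noncomputable def tradeoffMean : List ((X ⊕ Fin m) × Fin m × Fin m) → Fin m → ℝ
  | [], _ => 0
  | (_, i, j) :: l, t => 4 * tradeoffMean l t + ((if t = i then 2 else 0) + if t = j then 2 else 0)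

/-- An upper bound of `tradeoffCost`. -/
def tradeoffBound : List ((X ⊕ Fin m) × Fin m × Fin m) → ℕ
  | [] => 0
  | _ :: l => 4 * tradeoffBound l + 8

variable {e}

theorem bitTest_le_one (j : Fin k) (β : Bool) (b : Fin k → Bool) : bitTest j β b ≤ 1 := by
  unfold bitTest
  split_ifs <;> simp

theorem tradeoffCost_le (l : List ((X ⊕ Fin m) × Fin m × Fin m)) (t : Fin m)
    (b : Fin k → Bool) : tradeoffCost e l t b ≤ tradeoffBound l := by
  induction l with
  | nil => exact le_rfl
  | cons p l ih =>
    obtain ⟨w, i, j⟩ := p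
    have h1 := bitTest_le_one (e w) false b
    have h2 := bitTest_le_one (e w) true b
    simp only [tradeoffCost, tradeoffBound]
    split_ifs <;> omega

theorem tradeoffCost_congr (l : List ((X ⊕ Fin m) × Fin m × Fin m)) (t : Fin m)
    {b b' : Fin k → Bool} (h : ∀ w, Adjoined l t w → b (e w) = b' (e w)) :
    tradeoffCost e l t b = tradeoffCost e l t b' := by
  induction l with
  | nil => rfl
  | cons p l ih =>
    obtain ⟨w, i, j⟩ := p
    simp only [tradeoffCost]
    rw [ih fun w hw => h w (hw.mono (List.subset_cons_self _ _))]
    have h1 : t = i ∨ t = j → b (e w) = b' (e w) := by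
      rintro (rfl | rfl)
      · exact h w ⟨j, Or.inl List.mem_cons_self⟩
      · exact h w ⟨i, Or.inr List.mem_cons_self⟩
    simp only [bitTest]
    by_cases hi : t = i
    · rw [h1 (Or.inl hi)]
    · by_cases hj : t = j
      · rw [h1 (Or.inr hj)]
      · simp only [if_neg hi, if_neg hj]

theorem integral_tradeoffCost (l : List ((X ⊕ Fin m) × Fin m × Fin m)) (t : Fin m) :
    ∫ u, (tradeoffCost e l t (bits u) : ℝ) ∂coinLaw k = tradeoffMean l t := by
  induction l with
  | nil => simp [tradeoffCost, tradeoffMean]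
  | cons p l ih =>
    obtain ⟨w, i, j⟩ := p
    have hite : ∀ (P : Prop) [Decidable P] (β : Bool),
        ∫ u, (4 : ℝ) * (((if P then bitTest (e w) β (bits u) else 0 : ℕ) : ℝ)) ∂coinLaw k =
          if P then 2 else 0 := by
      intro P _ β
      by_cases hP : P
      · simp only [if_pos hP]
        rw [integral_const_mul, integral_bitTest]
        norm_num
      · simp [hP]
    simp only [tradeoffCost, tradeoffMean, Nat.cast_add, Nat.cast_mul, mul_add, Nat.cast_ofNat]
    rw [integral_add (integrable_comp_bits fun b => 4 * (tradeoffCost e l t b : ℝ)),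
      integral_add, hite, hite, integral_const_mul, ih]
    · exact integrable_comp_bits fun b =>
        4 * ((if t = i then bitTest (e w) false b else 0 : ℕ) : ℝ)
    · exact integrable_comp_bits fun b =>
        4 * ((if t = j then bitTest (e w) true b else 0 : ℕ) : ℝ)
    · exact integrable_comp_bits fun b =>
        4 * ((if t = i then bitTest (e w) false b else 0 : ℕ) : ℝ) +
          4 * ((if t = j then bitTest (e w) true b else 0 : ℕ) : ℝ)

end Cost

namespace SignalData

variable {X : Type*} [Finite X] {m : ℕ} {G : CausalGraph (X ⊕ Fin m)} {S : SignalData G}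
  {D : Set X} {x : D → ℝ} {e : X ⊕ Fin m → Fin S.k}
  {l : List ((X ⊕ Fin m) × Fin m × Fin m)}

theorem live_of_territory (he : ∀ v, e v ∈ S.exo v)
    (hle : S.scm.mean D x ≤ S.scm.mean S.s fun _ => 1)
    (hl : ∀ i v, Adjoined l i v → S.Live D i v) {i : Fin m} {v : X ⊕ Fin m}
    (h : Territory G S.s l i v) : S.Live D i v := by
  induction h with
  | target i => exact Relation.ReflTransGen.refl
  | adjoined h => exact hl _ _ h
  | @conf i v w _ hvw hw ih =>
    obtain ⟨j, hj, hj'⟩ := (S.conf_iff v w hvw.ne).1 hvw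
    exact live_of_mem_vis (hle i) ih hj ⟨w, Relation.ReflTransGen.refl, hj'⟩ hw
  | @child i v w _ hvw hw ih =>
    exact live_of_mem_vis (hle i) ih (he v)
      ⟨v, Relation.ReflTransGen.single ⟨hvw, ih.notMem.1⟩, he v⟩ hw
  | parent _ hwv _ _ ih ih' =>
    exact ih.edge_head hwv fun h => h.elim ih'.notMem.1 ih'.notMem.2

/-- If the trade-off costs, as perceived by the targets, are nowhere larger by more than `1` than
for fair bits, then the intervention leaves alone the territories: fixing a vertex `w` adjoined for
`i` and `j` makes the full charge of `w` fall on one of the two targets, which cannot be compensated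
by vertices that are adjoined later. -/
theorem live_of_tradeoff (he : ∀ v, e v ∈ S.exo v)
    (hle : S.scm.mean D x ≤ S.scm.mean S.s fun _ => 1) (hl : Admissible G S.s l)
    (g : Fin m → (Fin S.k → ℝ) → ℝ) (hint : ∀ t, Integrable (g t) (coinLaw S.k))
    (hg : ∀ t u, (tradeoffBound l : ℝ) ≤ g t u ∨
      ∃ b, S.View D x t u b ∧ (tradeoffCost e l t b : ℝ) ≤ g t u)
    (hmean : ∀ t, ∫ u, g t u ∂coinLaw S.k ≤ tradeoffMean l t + 1) :
    ∀ i v, Territory G S.s l i v → S.Live D i v := by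
  induction hl generalizing g with
  | nil => exact fun i v => live_of_territory he hle (by rintro i v ⟨j, h | h⟩ <;> simp at h)
  | @cons l w i j v v' hl hij hws hv hwv hv' hwv' ih =>
    -- Up to the factor `4`, the last charge only perturbs the costs of the shorter list, by at
    -- most `3 / 4` in the mean.
    have ihl : ∀ i v, Territory G S.s l i v → S.Live D i v := by
      refine ih (fun t u => g t u / 4) (fun t => (hint t).div_const 4) (fun t u => ?_) fun t => ?_
      · rcases hg t u with h | ⟨b, hb, h⟩
        · left
          simp only [tradeoffBound] at h
          push_cast at h
          linarith
        · refine Or.inr ⟨b, hb, ?_⟩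
          have h1 : 4 * tradeoffCost e l t b ≤ tradeoffCost e ((w, i, j) :: l) t b :=
            Nat.le_add_right _ _
          have h2 : (4 : ℝ) * tradeoffCost e l t b ≤ tradeoffCost e ((w, i, j) :: l) t b := by
            exact_mod_cast h1
          linarith
      · have h := hmean t
        rw [integral_div]
        simp only [tradeoffMean] at h
        split_ifs at h with h1 h2
        · exact absurd (h1.symm.trans h2) hij
        all_goals linarith
    -- A target that perceives the charge of `w` all the time has a mean cost that is too large.
    have key : ∀ t, t = i ∨ t = j → ¬ ∀ u b, S.View D x t u b →
        4 ≤ 4 * ((if t = i then bitTest (e w) false b else 0) +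
          if t = j then bitTest (e w) true b else 0) := by
      intro t ht hcharge
      have h1 : ∫ u, (4 * (tradeoffCost e l t (bits u) : ℝ) + 4) ∂coinLaw S.k ≤
          ∫ u, g t u ∂coinLaw S.k := by
        refine integral_mono (integrable_comp_bits fun b => 4 * (tradeoffCost e l t b : ℝ) + 4)
          (hint t) fun u => ?_
        rcases hg t u with h | ⟨b, hb, h⟩
        · have h2 : (tradeoffCost e l t (bits u) : ℝ) ≤ tradeoffBound l :=
            Nat.cast_le.2 (tradeoffCost_le l t _)
          simp only [tradeoffBound] at h
          push_cast at h
          simp only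
          linarith
        · have h2 : tradeoffCost e l t (bits u) = tradeoffCost e l t b :=
            tradeoffCost_congr l t fun w' hw' =>
              (hb.bit (ihl t w' (.adjoined hw')) (he w')).symm
          have h3 : 4 * tradeoffCost e l t b + 4 ≤ tradeoffCost e ((w, i, j) :: l) t b :=
            Nat.add_le_add_left (hcharge u b hb) _
          have h4 : (4 : ℝ) * tradeoffCost e l t b + 4 ≤ tradeoffCost e ((w, i, j) :: l) t b := by
            exact_mod_cast h3
          simp only [h2]
          linarith
      rw [integral_add (integrable_comp_bits fun b => 4 * (tradeoffCost e l t b : ℝ))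
        (integrable_const _), integral_const_mul, integral_tradeoffCost, integral_const,
        probReal_univ, one_smul] at h1
      have h2 := hmean t
      simp only [tradeoffMean] at h2
      split_ifs at h2 with h3 h4
      · exact hij (h3.symm.trans h4)
      all_goals linarith
    -- If `w` is fixed, then `i` and `j` perceive the same constant bit of `w`.
    have hwD : w ∉ Sum.inl '' D := by
      rintro ⟨d, hd, rfl⟩
      obtain ⟨u₀, b₀, hb₀⟩ := exists_view (hle i)
      have hconst : ∀ t a u b, S.View D x t u b → S.Live D t a → G.edge (Sum.inl d) a →
          x ⟨d, hd⟩ = S.signal (Sum.inl d) b := fun t a u b hb ha hda =>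
        (S.causalModel.doValue_of_mem x u hd).symm.trans (hb.parent ha hda)
      have hbit : ∀ t a u b, S.View D x t u b → S.Live D t a → G.edge (Sum.inl d) a →
          b (e (Sum.inl d)) = b₀ (e (Sum.inl d)) := fun t a u b hb ha hda =>
        eq_of_signal_eq hws ((hconst t a u b hb ha hda).symm.trans
          (hconst i v u₀ b₀ hb₀ (ihl i v hv) hwv)) ⟨_, Relation.ReflTransGen.refl, he _⟩
      cases hβ : b₀ (e (Sum.inl d)) with
      | false =>
        refine key i (Or.inl rfl) fun u b hb => ?_
        have := (hbit i v u b hb (ihl i v hv) hwv).trans hβ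
        simp only [bitTest, this, if_true]
        omega
      | true =>
        refine key j (Or.inr rfl) fun u b hb => ?_
        have := (hbit j v' u b hb (ihl j v' hv') hwv').trans hβ
        simp only [bitTest, this, if_true]
        omega
    refine fun i' v' => live_of_territory he hle fun k y hy => ?_
    rcases adjoined_cons hy with hy | ⟨rfl, rfl | rfl⟩
    · exact ihl k y (.adjoined hy)
    · exact (ihl _ _ hv).edge_head hwv fun h => h.elim hws hwD
    · exact (ihl _ _ hv').edge_head hwv' fun h => h.elim hws hwD

end SignalData

/-! ### Possibly Pareto-optimal sets -/

/-- Exogenous bits for a causal graph: one for each vertex and one for each bidirected edge. -/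
theorem CausalGraph.exists_exo {V : Type*} [Finite V] (G : CausalGraph V) :
    ∃ (k : ℕ) (exo : V → Set (Fin k)) (e : V → Fin k),
      (∀ v w, v ≠ w → (G.conf.Adj v w ↔ (exo v ∩ exo w).Nonempty)) ∧ ∀ v, e v ∈ exo v := by
  let E := Finite.equivFin (Sym2 V)
  refine ⟨_, fun v => {j | v ∈ E.symm j ∧ ((E.symm j).IsDiag ∨ E.symm j ∈ G.conf.edgeSet)},
    fun v => E s(v, v), fun v w hvw => ⟨fun h => ⟨E s(v, w), ?_⟩, ?_⟩, fun v => ?_⟩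
  · simp [h]
  · rintro ⟨j, ⟨hv, h⟩, hw, -⟩
    rw [(Sym2.mem_and_mem_iff hvw).1 ⟨hv, hw⟩] at h
    simpa [hvw] using h
  · simp

section

variable {X : Type*} [Finite X] {m : ℕ} {G : CausalGraph (X ⊕ Fin m)}

/-- If the treatments may take values outside of their interventional domains, then every minimal
intervention set is possibly Pareto-optimal: let a treatment reveal by its value whether it has
been set. -/
theorem IsMinimalInterventionSet.mem_possiblyParetoOptimalMIS {s : Set X}
    (hs : IsMinimalInterventionSet (G := G) Set.univ s) :
    s ∈ possiblyParetoOptimalMIS (G := G) Set.univ := by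
  obtain ⟨k, exo, e, hconf, -⟩ := G.exists_exo
  let S : SignalData G :=
    { s := s
      k := k
      exo := exo
      conf_iff := hconf
      cost := fun _ _ => 0
      cost_congr := fun _ _ _ _ => rfl
      cost_inl := fun _ _ => rfl
      bound := 0
      cost_le := fun _ _ => le_rfl
      -- All signals of non-intervened treatments lie in `[0, 1)`.
      dom := Set.Ici 1
      dom_ordConnected := Set.ordConnected_Ici
      dom_nontrivial := ⟨1, by simp, 2, by simp, by norm_num⟩
      one_mem := by simp }
  refine _root_.mem_possiblyParetoOptimalMIS (M := S.scm) (x := fun _ => 1) trivial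
    (fun _ => S.one_mem) fun D hD x hx hle => ?_
  refine SignalData.eq_of_forall_live hD hle (fun t ht => ?_) fun i w hw => ?_
  · exact hs.exists_edge_anc ht
  · rcases hw.union_or (C := Sum.inl '' D) with h | ⟨_, a, ⟨d, hdD, rfl⟩, hds, hda, ha, -⟩
    · exact h
    · exfalso
      obtain ⟨u, b, hb⟩ := SignalData.exists_view (hle i)
      have h1 := (S.causalModel.doValue_of_mem x u hdD).symm.trans (hb.parent ha hda)
      have h2 : (1 : ℝ) ≤ x ⟨d, hdD⟩ := hx ⟨d, hdD⟩
      have h3 := SignalData.signal_lt hds b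
      rw [S.cost_inl, Nat.cast_zero, zero_add] at h3
      linarith

/-- A set of parents of vertices with a path to a target that avoids the set is possibly
Pareto-optimal, with domain-closed models, if all the vertices with such a path belong to the
territory of the target. -/
theorem mem_possiblyParetoOptimalMIS_domainClosed {s : Set X}
    {l : List ((X ⊕ Fin m) × Fin m × Fin m)} (hl : Admissible G s l)
    (hs : ∀ t ∈ s, ∃ i a, G.Anc (Sum.inl '' s) a (Sum.inr i) ∧ G.edge (Sum.inl t) a)
    (hT : ∀ i v, G.Anc (Sum.inl '' s) v (Sum.inr i) → Territory G s l i v) :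
    s ∈ possiblyParetoOptimalMIS (G := G) {M | M.DomainClosed} := by
  obtain ⟨k, exo, e, hconf, he⟩ := G.exists_exo
  let S : SignalData G :=
    { s := s
      k := k
      exo := exo
      conf_iff := hconf
      cost := fun v b => Sum.elim (fun _ => 0) (fun i => tradeoffCost e l i b) v
      cost_congr := by
        rintro (t | i) b b' h
        · rfl
        · exact tradeoffCost_congr l i fun w hw => h _ ⟨w, hl.anc_of_adjoined i w hw, he w⟩
      cost_inl := fun _ _ => rfl
      bound := tradeoffBound l
      cost_le := by
        rintro (t | i) b
        · exact Nat.zero_le _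
        · exact tradeoffCost_le l i b
      dom := Set.univ
      dom_ordConnected := Set.ordConnected_univ
      dom_nontrivial := Set.nontrivial_univ
      one_mem := trivial }
  refine mem_possiblyParetoOptimalMIS (M := S.scm) (x := fun _ => 1) (fun _ _ _ => trivial)
    (fun _ => trivial) fun D hD x _ hle => ?_
  refine SignalData.eq_of_forall_live hD hle hs fun i w hw => ?_
  refine SignalData.live_of_tradeoff (S := S) (e := e) he hle hl
    (fun t u => S.causalModel.doValue D x u (Sum.inr t)) (S.integrable_doValue D x)
    (fun t u => ?_) (fun t => ?_) i w (hT i w hw)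
  · rcases S.err_or_view D x t u with h | ⟨b, hb⟩
    · left
      rw [h]
      simp only [SignalData.err, S]
      linarith [(Nat.cast_nonneg (tradeoffBound l) : (0 : ℝ) ≤ tradeoffBound l)]
    · exact Or.inr ⟨b, hb,
        (SignalData.cost_le_signal (SignalData.inr_notMem _ t) b).trans_eq hb.symm⟩
  · refine (hle t).trans ((S.mean_one_le t).trans_eq ?_)
    rw [← integral_tradeoffCost (e := e)]
    rfl

end

/-! ### Intervening on the boundary of the territories -/

/-- `glue F u u'` agrees with `u` on `F` and with `u'` outside of `F`. -/
noncomputable def glue {k : ℕ} (F : Set (Fin k)) (u u' : Fin k → ℝ) : Fin k → ℝ :=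
  open Classical in fun j => if j ∈ F then u j else u' j

theorem measurePreserving_glue {k : ℕ} (F : Set (Fin k)) (μ : Fin k → Measure ℝ)
    [∀ j, IsProbabilityMeasure (μ j)] :
    MeasurePreserving (fun p : (Fin k → ℝ) × (Fin k → ℝ) => glue F p.2 p.1)
      ((Measure.pi μ).prod (Measure.pi μ)) (Measure.pi μ) := by
  classical
  have hm : Measurable fun p : (Fin k → ℝ) × (Fin k → ℝ) => glue F p.2 p.1 := by
    refine measurable_pi_lambda _ fun j => ?_
    by_cases hj : j ∈ F
    · simp only [glue, if_pos hj]
      exact (measurable_pi_apply j).comp measurable_snd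
    · simp only [glue, if_neg hj]
      exact (measurable_pi_apply j).comp measurable_fst
  refine ⟨hm, (Measure.pi_eq fun s hs => ?_).symm⟩
  have hpre : (fun p : (Fin k → ℝ) × (Fin k → ℝ) => glue F p.2 p.1) ⁻¹' Set.univ.pi s =
      (Set.univ.pi fun j => if j ∈ F then Set.univ else s j) ×ˢ
        Set.univ.pi fun j => if j ∈ F then s j else Set.univ := by
    ext p
    simp only [Set.mem_preimage, Set.mem_pi, Set.mem_univ, true_imp_iff, Set.mem_prod, ← forall_and]
    refine forall_congr' fun j => ?_
    by_cases hj : j ∈ F <;> simp [glue, hj]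
  rw [Measure.map_apply hm (MeasurableSet.univ_pi hs), hpre, Measure.prod_prod, Measure.pi_pi,
    Measure.pi_pi, ← Finset.prod_mul_distrib]
  refine Finset.prod_congr rfl fun j _ => ?_
  by_cases hj : j ∈ F <;> simp [hj]

section Boundary

variable {X : Type*} {m : ℕ} {G : CausalGraph (X ⊕ Fin m)}
  {s : Set X} {l : List ((X ⊕ Fin m) × Fin m × Fin m)} {i : Fin m} {v w : X ⊕ Fin m}

/-- The treatments that are a parent of the territory of some target, without belonging to this
territory. -/
def boundary (G : CausalGraph (X ⊕ Fin m)) (s : Set X)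
    (l : List ((X ⊕ Fin m) × Fin m × Fin m)) : Set X :=
  {t | ∃ i a, Territory G s l i a ∧ G.edge (Sum.inl t) a ∧ ¬ Territory G s l i (Sum.inl t)}

theorem Territory.notMem_boundary (h : Territory G s l i v) (hl : Admissible G s l) :
    v ∉ Sum.inl '' boundary G s l := by
  rintro ⟨t, ⟨j, a, ha, hta, hn⟩, rfl⟩
  exact hn (.parent ha hta (h.notMem hl) h)

theorem Territory.parent_mem_boundary (h : Territory G s l i v) (hwv : G.edge w v)
    (hw : ¬ Territory G s l i w) : w ∈ Sum.inl '' boundary G s l := by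
  cases w with
  | inl t => exact ⟨t, ⟨i, v, h, hwv, hw⟩, rfl⟩
  | inr j => exact absurd (.parent h hwv (by simp) (.target j)) hw

theorem anc_boundary_iff (hl : Admissible G s l) :
    G.Anc (Sum.inl '' boundary G s l) v (Sum.inr i) ↔ Territory G s l i v := by
  constructor
  · intro h
    induction h using Relation.ReflTransGen.head_induction_on with
    | refl => exact .target i
    | @head v w hvw _ ih =>
      by_contra hv
      exact hvw.2 (ih.parent_mem_boundary hvw.1 hv)
  · intro h
    have hanc := h.anc hl
    induction hanc using Relation.ReflTransGen.head_induction_on with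
    | refl => exact Relation.ReflTransGen.refl
    | @head v w hvw hw ih =>
      exact (ih (.child h hvw.1 hw)).edge_head hvw.1 (h.notMem_boundary hl)

theorem Territory.boundary_of_subset (hl : Admissible G s l)
    {l' : List ((X ⊕ Fin m) × Fin m × Fin m)} (hl' : l' ⊆ l) (h : Territory G s l' i v) :
    Territory G (boundary G s l) l' i v := by
  induction h with
  | target i => exact .target i
  | adjoined h => exact .adjoined h
  | conf h h1 h2 ih =>
    exact .conf ih h1 ((anc_boundary_iff hl).2 (Territory.mono (.conf h h1 h2) hl'))
  | child h h1 h2 ih =>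
    exact .child ih h1 ((anc_boundary_iff hl).2 (Territory.mono (.child h h1 h2) hl'))
  | parent _ h1 _ h3 ih ih' =>
    exact .parent ih h1 ((h3.mono hl').notMem_boundary hl) ih'

theorem Admissible.boundary_of_subset (hl : Admissible G s l)
    {l' : List ((X ⊕ Fin m) × Fin m × Fin m)} (hl' : l' ⊆ l) (h : Admissible G s l') :
    Admissible G (boundary G s l) l' := by
  induction h with
  | nil => exact .nil
  | @cons l' w i j v v' h hij hw hv hwv hv' hwv' ih =>
    have hsub : l' ⊆ l := List.Subset.trans (List.subset_cons_self _ _) hl'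
    have hmem : Territory G s l i w := .adjoined ⟨j, Or.inl (hl' List.mem_cons_self)⟩
    exact .cons (ih hsub) hij (hmem.notMem_boundary hl) (hv.boundary_of_subset hl hsub) hwv
      (hv'.boundary_of_subset hl hsub) hwv'

variable [Finite X]

theorem boundary_mem_possiblyParetoOptimalMIS (hl : Admissible G s l) :
    boundary G s l ∈ possiblyParetoOptimalMIS (G := G) {M | M.DomainClosed} := by
  refine mem_possiblyParetoOptimalMIS_domainClosed
    (hl.boundary_of_subset (List.Subset.refl l) hl) (fun t ht => ?_) fun i v hv => ?_
  · obtain ⟨i, a, ha, hta, -⟩ := ht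
    exact ⟨i, a, (anc_boundary_iff hl).2 ha, hta⟩
  · exact ((anc_boundary_iff hl).1 hv).boundary_of_subset hl (List.Subset.refl l)

namespace CausalModel

variable {M : CausalModel G} {x : s → ℝ} {u u' : Fin M.k → ℝ}

/-- The exogenous variables that affect the territory of the target `i`. -/
def territoryExo (M : CausalModel G) (s : Set X) (l : List ((X ⊕ Fin m) × Fin m × Fin m))
    (i : Fin m) : Set (Fin M.k) :=
  {j | ∃ a, Territory G s l i a ∧ j ∈ M.exo a}

/-- The effective ancestors of a target outside of its territory are not affected by the exogenous
variables of the territory, as the latter is closed under confounding and under children. -/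
theorem doValue_glue_of_not_territory (hv : ¬ Territory G s l i v)
    (hanc : v ∈ Sum.inl '' s ∨ G.Anc (Sum.inl '' s) v (Sum.inr i)) :
    M.doValue s x (glue (M.territoryExo s l i) u u') v = M.doValue s x u' v := by
  induction v using G.wellFounded.induction with
  | _ v ih =>
    by_cases hvs : v ∈ Sum.inl '' s
    · obtain ⟨t, ht, rfl⟩ := hvs
      rw [doValue_of_mem _ _ _ ht, doValue_of_mem _ _ _ ht]
    have hanc := hanc.resolve_left hvs
    rw [doValue_of_notMem _ _ _ hvs, doValue_of_notMem _ _ _ hvs]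
    congr 1
    · funext ⟨w, hw⟩
      refine ih w hw (fun h => hv (.child h hw hanc)) ?_
      by_cases hws : w ∈ Sum.inl '' s
      · exact Or.inl hws
      · exact Or.inr (hanc.edge_head hw hws)
    · funext ⟨j, hj⟩
      have hjF : j ∉ M.territoryExo s l i := by
        rintro ⟨a, ha, hja⟩
        have hav : a ≠ v := fun h => hv (h ▸ ha)
        exact hv (.conf ha ((M.conf_iff a v hav).2 ⟨j, hja, hj⟩) hanc)
      simp only [glue, if_neg hjF]

/-- If the boundary of the territory of a target is set to the values that it has when the
exogenous variables are `u'`, then the territory behaves as under the original intervention with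
the exogenous variables of the territory given by `u`, and all others by `u'`. -/
theorem doValue_glue_of_territory (hl : Admissible G s l) (hv : Territory G s l i v)
    {y : boundary G s l → ℝ}
    (hy : ∀ (t : boundary G s l) a, Territory G s l i a → G.edge (Sum.inl t.1) a →
      y t = M.doValue s x u' (Sum.inl t.1)) :
    M.doValue s x (glue (M.territoryExo s l i) u u') v = M.doValue (boundary G s l) y u v := by
  induction v using G.wellFounded.induction with
  | _ v ih =>
    rw [doValue_of_notMem _ _ _ (hv.notMem hl), doValue_of_notMem _ _ _ (hv.notMem_boundary hl)]
    congr 1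
    · funext ⟨w, hw⟩
      by_cases hwT : Territory G s l i w
      · exact ih w hw hwT
      · obtain ⟨t, ht, rfl⟩ := hv.parent_mem_boundary hw hwT
        simp only
        rw [doValue_of_mem _ _ _ ht, hy ⟨t, ht⟩ v hv hw]
        refine doValue_glue_of_not_territory hwT ?_
        by_cases hts : (Sum.inl t : X ⊕ Fin m) ∈ Sum.inl '' s
        · exact Or.inl hts
        · exact Or.inr ((hv.anc hl).edge_head hw hts)
    · funext ⟨j, hj⟩
      have hjF : j ∈ M.territoryExo s l i := ⟨v, hv, hj⟩
      simp only [glue, if_pos hjF]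

end CausalModel

/-- The treatments that a domain-closed model sets naturally also lie in their interventional
domains. -/
theorem SCM.DomainClosed.doValue_mem {M : SCM G} (hM : M.DomainClosed) {x : s → ℝ}
    (hx : x ∈ M.idom s) (u : Fin M.k → ℝ) (t : X) : M.doValue s x u (Sum.inl t) ∈ M.dom t := by
  by_cases ht : t ∈ s
  · rw [CausalModel.doValue_of_mem _ _ _ ht]
    exact hx ⟨t, ht⟩
  · rw [CausalModel.doValue_of_notMem _ _ _ (by simpa using ht)]
    exact hM _ _ _

/-- For each target separately, its mean is an average over the values of the boundary of its
territory; some of these values are at least as good as the average. -/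
theorem SCM.exists_integral_glue_le (M : SCM G) {x : s → ℝ} (hx : x ∈ M.idom s) (i : Fin m)
    (F : Set (Fin M.k)) :
    ∃ u', ∫ u, M.doValue s x (glue F u u') (Sum.inr i) ∂M.exoLaw ≤ M.mean s x i := by
  have := M.isProb
  have hmp : MeasurePreserving (fun p : (Fin M.k → ℝ) × (Fin M.k → ℝ) => glue F p.2 p.1)
      (M.exoLaw.prod M.exoLaw) M.exoLaw := measurePreserving_glue F M.law
  have hmeas := M.measurable_doValue s x (Sum.inr i)
  have hint := (hmp.integrable_comp hmeas.aestronglyMeasurable).2 (M.integrable s x hx i)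
  obtain ⟨u', hu'⟩ := exists_le_integral hint.integral_prod_left
  have hmap := integral_map (μ := M.exoLaw.prod M.exoLaw) hmp.measurable.aemeasurable
    hmeas.aestronglyMeasurable
  rw [hmp.map_eq] at hmap
  exact ⟨u', hu'.trans_eq ((integral_prod _ hint).symm.trans hmap.symm)⟩

/-- If distinct territories have no common parents outside of `s`, then the best values of their
boundaries can be chosen independently. -/
theorem SCM.DomainClosed.exists_boundary_le {M : SCM G} (hM : M.DomainClosed)
    (hl : Admissible G s l)
    (hclosed : ∀ i j v v' w, i ≠ j → w ∉ Sum.inl '' s → Territory G s l i v → G.edge w v →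
      Territory G s l j v' → G.edge w v' → Territory G s l i w)
    {x : s → ℝ} (hx : x ∈ M.idom s) :
    ∃ y ∈ M.idom (boundary G s l), M.mean (boundary G s l) y ≤ M.mean s x := by
  choose r hr using fun i => M.exists_integral_glue_le hx i (M.territoryExo s l i)
  choose idx a ha hedge using fun t : boundary G s l => t.2
  refine ⟨fun t => M.doValue s x (r (idx t)) (Sum.inl t.1),
    fun t => hM.doValue_mem hx _ _, fun i => ?_⟩
  refine le_of_eq_of_le ?_ (hr i)
  refine integral_congr_ae (ae_of_all _ fun u => ?_)
  refine (CausalModel.doValue_glue_of_territory hl (.target i) fun t b hb htb => ?_).symm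
  by_cases hts : t.1 ∈ s
  · rw [CausalModel.doValue_of_mem _ _ _ hts, CausalModel.doValue_of_mem _ _ _ hts]
  · have hi : idx t = i := by
      by_contra hne
      exact (hedge t).2 (hclosed _ _ _ _ _ hne (by simpa using hts) (ha t) (hedge t).1 hb htb)
    rw [hi]

end Boundary

theorem mainTheorem2 {X : Type*} [Finite X] {m : ℕ} (G : CausalGraph (X ⊕ Fin m))
    (K : Set (SCM G)) (hK : K = Set.univ ∨ K = {M | M.DomainClosed})
    (M : SCM G) (hM : M ∈ K) :
    M.causalParetoFront Set.univ = M.causalParetoFront (possiblyParetoOptimalMIS K) := by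
  refine M.causalParetoFront_univ_eq fun s x hx => ?_
  rcases hK with rfl | rfl
  · obtain ⟨s', hs', hmin, hmean⟩ := exists_isMinimalInterventionSet Set.univ s
    exact ⟨s', hmin.mem_possiblyParetoOptimalMIS, x ∘ Set.inclusion hs',
      fun t => hx (Set.inclusion hs' t), (hmean M hM x hx).ge⟩
  · obtain ⟨l, hl, hclosed⟩ := exists_admissible_closed G s
    obtain ⟨y, hy, hle⟩ := SCM.DomainClosed.exists_boundary_le hM hl hclosed hx
    exact ⟨boundary G s l, boundary_mem_possiblyParetoOptimalMIS hl, y, hy, hle⟩
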